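/- For $\lambda\in(0,1/2]$ let $K_\lambda\subset\mathbb R$ be the self-similar set generated by the iterated function system $\{f_{\lambda,d}(y)=\lambda y+d(1-\lambda): d=0,1\}$, i.e. the unique nonempty compact set with $$K_\lambda=f_{\lambda,0}(K_\lambda)\cup f_{\lambda,1}(K_\lambda)=\Big\{(1-\lambda)\sum_{n=1}^\infty i_n\lambda^{n-1}: i_n\in\{0,1\}\ \forall n\ge 1\Big\}.$$ For $x\in(0,1/2)$ let $\Lambda(x)=\{\lambda\in(0,1/2]: x\in K_\lambda\}$, and let $\dim_H$ denote Hausdorff dimension. Then for every $x\in(0,1/2)$ the set $\Lambda(x)$ has Lebesgue measure zero and $\dim_H\Lambda(x)=1$. Furthermore, for every $\lambda\in\Lambda(x)$, $$\lim_{\delta\to0^+}\dim_H\big(\Lambda(x)\cap(\lambda-\delta,\lambda+\delta)\big)=\frac{\log 2}{-\log\lambda}=\dim_H K_\lambda .$$ -/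

import Mathlib

open MeasureTheory Set Filter Topology

noncomputable section

namespace CantorParam

/-- The maps `f_{l,d}(y) = l y + d (1 - l)`, `d ∈ {0, 1}`, of the iterated function system. -/
def ifsMap (l : ℝ) (d : Fin 2) (y : ℝ) : ℝ := l * y + (d : ℕ) * (1 - l)

/-- `K` is a nonempty compact set with `K = f_{l,0}(K) ∪ f_{l,1}(K)`. -/
def IsAttractor (l : ℝ) (K : Set ℝ) : Prop :=
  K.Nonempty ∧ IsCompact K ∧ K = ifsMap l 0 '' K ∪ ifsMap l 1 '' K

/-- The coding map `(i_n) ↦ (1 - l) ∑_{n ≥ 0} i_n l^n`. -/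
def coding (l : ℝ) (i : ℕ → Fin 2) : ℝ := (1 - l) * ∑' n : ℕ, ((i n : ℕ) : ℝ) * l ^ n

/-- The self-similar set `K_l = {(1 - l) ∑_{n ≥ 0} i_n l^n : i_n ∈ {0, 1}}`. By
`isAttractor_iff` below, for `0 < l < 1` it is the unique nonempty compact set with
`K = f_{l,0}(K) ∪ f_{l,1}(K)`. -/
def selfSimilarSet (l : ℝ) : Set ℝ := Set.range (coding l)

/-- `Λ(x) = {l ∈ (0, 1/2] : x ∈ K_l}`. -/
def paramSet (x : ℝ) : Set ℝ := {l : ℝ | l ∈ Set.Ioc (0 : ℝ) (1 / 2) ∧ x ∈ selfSimilarSet l}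

theorem digit_le_one (d : Fin 2) : ((d : ℕ) : ℝ) ≤ 1 := by
  exact_mod_cast Nat.lt_succ_iff.mp d.isLt

theorem summable_digits {l : ℝ} (h0 : 0 < l) (h1 : l < 1) (i : ℕ → Fin 2) :
    Summable fun n : ℕ => ((i n : ℕ) : ℝ) * l ^ n := by
  refine Summable.of_nonneg_of_le (fun n => by positivity) (fun n => ?_)
    (summable_geometric_of_lt_one h0.le h1)
  exact mul_le_of_le_one_left (by positivity) (digit_le_one _)

theorem continuous_coding {l : ℝ} (h0 : 0 < l) (h1 : l < 1) : Continuous (coding l) := by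
  refine continuous_const.mul (continuous_tsum (u := fun n => l ^ n) (fun n => ?_)
    (summable_geometric_of_lt_one h0.le h1) fun n i => ?_)
  · exact ((continuous_of_discreteTopology (f := fun d : Fin 2 => ((d : ℕ) : ℝ))).comp
      (continuous_apply n)).mul continuous_const
  · rw [Real.norm_of_nonneg (by positivity)]
    exact mul_le_of_le_one_left (by positivity) (digit_le_one _)

theorem coding_eq {l : ℝ} (h0 : 0 < l) (h1 : l < 1) (i : ℕ → Fin 2) :
    coding l i = ifsMap l (i 0) (coding l fun n => i (n + 1)) := by
  unfold coding ifsMap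
  rw [(summable_digits h0 h1 i).tsum_eq_zero_add]
  have : ∑' n : ℕ, ((i (n + 1) : ℕ) : ℝ) * l ^ (n + 1)
      = l * ∑' n : ℕ, ((i (n + 1) : ℕ) : ℝ) * l ^ n := by
    rw [← tsum_mul_left]
    exact tsum_congr fun n => by ring
  rw [this]
  ring

theorem mem_ifs_iff {l : ℝ} {K : Set ℝ} {y : ℝ} :
    y ∈ ifsMap l 0 '' K ∪ ifsMap l 1 '' K ↔ ∃ d : Fin 2, ∃ z ∈ K, ifsMap l d z = y := by
  rw [Fin.exists_fin_two]
  rfl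

theorem isAttractor_selfSimilarSet {l : ℝ} (h0 : 0 < l) (h1 : l < 1) :
    IsAttractor l (selfSimilarSet l) := by
  refine ⟨range_nonempty _, isCompact_range (continuous_coding h0 h1), ?_⟩
  ext y
  rw [mem_ifs_iff]
  constructor
  · rintro ⟨i, rfl⟩
    exact ⟨i 0, _, ⟨fun n => i (n + 1), rfl⟩, (coding_eq h0 h1 i).symm⟩
  · rintro ⟨d, _, ⟨i, rfl⟩, rfl⟩
    exact ⟨fun n => Nat.casesOn n d i, coding_eq h0 h1 _⟩

theorem dist_coding_le {l : ℝ} (h0 : 0 < l) (h1 : l < 1) {C : ℝ} (i : ℕ → Fin 2) (z : ℕ → ℝ)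
    (hz : ∀ n, z n = ifsMap l (i n) (z (n + 1))) (N : ℕ)
    (hC : |z N - coding l fun n => i (n + N)| ≤ C) :
    |z 0 - coding l i| ≤ l ^ N * C := by
  induction N generalizing i z with
  | zero => simpa using hC
  | succ N ih =>
    have h := ih (fun n => i (n + 1)) (fun n => z (n + 1)) (fun n => hz (n + 1)) hC
    rw [hz 0, coding_eq h0 h1 i]
    have e : ifsMap l (i 0) (z (0 + 1)) - ifsMap l (i 0) (coding l fun n => i (n + 1))
        = l * (z (0 + 1) - coding l fun n => i (n + 1)) := by
      unfold ifsMap; ring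
    rw [e, abs_mul, abs_of_pos h0, pow_succ']
    calc l * _ ≤ l * (l ^ N * C) := mul_le_mul_of_nonneg_left h h0.le
      _ = l * l ^ N * C := by ring

/-- `selfSimilarSet l` is the unique nonempty compact set invariant under the system. -/
theorem isAttractor_iff {l : ℝ} (h0 : 0 < l) (h1 : l < 1) (K : Set ℝ) :
    IsAttractor l K ↔ K = selfSimilarSet l := by
  refine ⟨fun hK => ?_, fun h => h ▸ isAttractor_selfSimilarSet h0 h1⟩
  obtain ⟨hne, hc, hK⟩ := hK
  obtain ⟨-, hc', -⟩ := isAttractor_selfSimilarSet h0 h1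
  obtain ⟨A, hA⟩ := hc.isBounded.exists_norm_le
  obtain ⟨B, hB⟩ := hc'.isBounded.exists_norm_le
  have hAB : ∀ y ∈ K, ∀ i, |y - coding l i| ≤ A + B := fun y hy i =>
    (norm_sub_le _ _).trans (add_le_add (hA y hy) (hB _ ⟨i, rfl⟩))
  have hlim : Tendsto (fun N : ℕ => l ^ N * (A + B)) atTop (𝓝 0) := by
    simpa using (tendsto_pow_atTop_nhds_zero_of_lt_one h0.le h1).mul_const (A + B)
  apply Subset.antisymm
  · intro y hy
    have step : ∀ w : K, ∃ p : Fin 2 × K, ifsMap l p.1 p.2 = w := by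
      rintro ⟨w, hw⟩
      rw [hK, mem_ifs_iff] at hw
      obtain ⟨d, z, hz, h⟩ := hw
      exact ⟨(d, ⟨z, hz⟩), h⟩
    choose p hp using step
    let z : ℕ → K := fun n => (fun w => (p w).2)^[n] ⟨y, hy⟩
    have hz : ∀ n, (z n : ℝ) = ifsMap l (p (z n)).1 (z (n + 1)) := fun n => by
      have : z (n + 1) = (p (z n)).2 := Function.iterate_succ_apply' _ _ _
      rw [this, hp]
    refine ⟨fun n => (p (z n)).1, ?_⟩
    have hle : |y - coding l fun n => (p (z n)).1| ≤ 0 :=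
      ge_of_tendsto' hlim fun N =>
        dist_coding_le h0 h1 _ (fun n => (z n : ℝ)) hz N (hAB _ (z N).2 _)
    exact (sub_eq_zero.mp (abs_nonpos_iff.mp hle)).symm
  · rintro _ ⟨i, rfl⟩
    obtain ⟨y, hy⟩ := hne
    have key : ∀ (N : ℕ) (i : ℕ → Fin 2), ∃ w ∈ K, |w - coding l i| ≤ l ^ N * (A + B) := by
      intro N
      induction N with
      | zero => exact fun i => ⟨y, hy, by simpa using hAB y hy i⟩
      | succ N ih =>
        intro i
        obtain ⟨w, hw, h⟩ := ih fun n => i (n + 1)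
        refine ⟨ifsMap l (i 0) w, by rw [hK, mem_ifs_iff]; exact ⟨_, w, hw, rfl⟩, ?_⟩
        have e : ifsMap l (i 0) w - ifsMap l (i 0) (coding l fun n => i (n + 1))
            = l * (w - coding l fun n => i (n + 1)) := by
          unfold ifsMap; ring
        rw [coding_eq h0 h1 i, e, abs_mul, abs_of_pos h0, pow_succ']
        calc l * _ ≤ l * (l ^ N * (A + B)) := mul_le_mul_of_nonneg_left h h0.le
          _ = l * l ^ N * (A + B) := by ring
    choose w hw hwl using fun N => key N i
    refine hc.isClosed.mem_of_tendsto (f := w) (b := atTop) ?_ (Eventually.of_forall hw)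
    exact tendsto_iff_dist_tendsto_zero.mpr
      (squeeze_zero (fun _ => dist_nonneg) hwl hlim)

end CantorParam

end

noncomputable section

namespace CantorParam

/-! Since `x < 1/2`, every code of `x` starts with `0`, and the value of such a code, when positive,
strictly increases with the ratio on `(0, 1/2]`. So a code determines its parameter, and the
parameter set is parametrised by codes. On ratios at most `b < 1/2` the increase has speed at least
`x * (1 - 2 * b)`, so codes sharing `n` digits have parameters within a constant times `b ^ n`;
counting `2 ^ n` cylinders bounds the dimension above (`dimH_paramSet_inter_le`). Conversely, codes
first differing at digit `n` are separated by `(1 - 2 * l) * l ^ n`, while values are 2-Lipschitz in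
the ratio, so parameters at least `a` are separated by a constant times `a ^ n`. A whole cylinder of
codes occurs near any parameter, and reading it in binary is a Hölder map onto an interval, which
bounds the dimension below (`le_dimH_paramSet_inter`). Squeezing gives the local limit; at `l = 1/2`
it gives full dimension. Nullity follows from dimension below 1 away from `1/2`. -/

/-! ### Cylinder estimates at a fixed ratio -/

theorem coding_nonneg {l : ℝ} (h0 : 0 < l) (h1 : l < 1) (i : ℕ → Fin 2) : 0 ≤ coding l i :=
  mul_nonneg (by linarith) (tsum_nonneg fun n => by positivity)

theorem coding_le_one {l : ℝ} (h0 : 0 < l) (h1 : l < 1) (i : ℕ → Fin 2) : coding l i ≤ 1 := by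
  have h : ∑' n : ℕ, ((i n : ℕ) : ℝ) * l ^ n ≤ ∑' n : ℕ, l ^ n :=
    (summable_digits h0 h1 i).tsum_le_tsum
      (fun n => mul_le_of_le_one_left (by positivity) (digit_le_one _))
      (summable_geometric_of_lt_one h0.le h1)
  rw [tsum_geometric_of_lt_one h0.le h1] at h
  have h2 : 0 < 1 - l := by linarith
  calc coding l i ≤ (1 - l) * (1 - l)⁻¹ := mul_le_mul_of_nonneg_left h h2.le
    _ = 1 := mul_inv_cancel₀ h2.ne'

theorem abs_coding_sub_coding_le_one {l : ℝ} (h0 : 0 < l) (h1 : l < 1) (i j : ℕ → Fin 2) :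
    |coding l i - coding l j| ≤ 1 := by
  have := coding_nonneg h0 h1 i
  have := coding_nonneg h0 h1 j
  have := coding_le_one h0 h1 i
  have := coding_le_one h0 h1 j
  rw [abs_le]; constructor <;> linarith

/-- Codings of sequences with the same first digit. -/
theorem coding_sub_of_head_eq {l : ℝ} (h0 : 0 < l) (h1 : l < 1) {i j : ℕ → Fin 2}
    (h : i 0 = j 0) : coding l i - coding l j =
      l * (coding l (fun n => i (n + 1)) - coding l (fun n => j (n + 1))) := by
  rw [coding_eq h0 h1 i, coding_eq h0 h1 j, h]
  unfold ifsMap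
  ring

/-- Sequences with a common prefix of length `n` have codings at distance at most `l ^ n`. -/
theorem abs_coding_sub_le {l : ℝ} (h0 : 0 < l) (h1 : l < 1) (n : ℕ) (i j : ℕ → Fin 2)
    (h : ∀ k < n, i k = j k) : |coding l i - coding l j| ≤ l ^ n := by
  induction n generalizing i j with
  | zero => simpa using abs_coding_sub_coding_le_one h0 h1 i j
  | succ n ih =>
    rw [coding_sub_of_head_eq h0 h1 (h 0 n.succ_pos), abs_mul, abs_of_pos h0, pow_succ']
    exact mul_le_mul_of_nonneg_left (ih _ _ fun k hk => h (k + 1) (by omega)) h0.le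

/-- Sequences whose first difference is at index `n` have codings at distance at least
`(1 - 2 l) l ^ n`. -/
theorem le_abs_coding_sub {l : ℝ} (h0 : 0 < l) (h1 : l < 1) (n : ℕ) (i j : ℕ → Fin 2)
    (h : ∀ k < n, i k = j k) (hn : i n ≠ j n) :
    (1 - 2 * l) * l ^ n ≤ |coding l i - coding l j| := by
  induction n generalizing i j with
  | zero =>
    have hb := mul_le_mul_of_nonneg_left (abs_coding_sub_coding_le_one h0 h1
      (fun n => i (n + 1)) (fun n => j (n + 1))) h0.le
    rw [← abs_of_pos h0, ← abs_mul, abs_of_pos h0, mul_sub, abs_le] at hb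
    rw [coding_eq h0 h1 i, coding_eq h0 h1 j, le_abs]
    unfold ifsMap
    generalize i 0 = p at *
    generalize j 0 = q at *
    fin_cases p <;> fin_cases q <;> simp at hn ⊢
    · right; linarith
    · left; linarith
  | succ n ih =>
    rw [coding_sub_of_head_eq h0 h1 (h 0 n.succ_pos), abs_mul, abs_of_pos h0, pow_succ',
      mul_left_comm]
    exact mul_le_mul_of_nonneg_left (ih _ _ (fun k hk => h (k + 1) (by omega)) hn) h0.le

/-! ### Dependence of the coding on the ratio -/

/-- The coding of a fixed sequence depends on the ratio in a `2`-Lipschitz way. -/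
theorem abs_coding_sub_le_two_mul {l m : ℝ} (hl0 : 0 < l) (hl1 : l ≤ 1 / 2) (hm0 : 0 < m)
    (hm1 : m ≤ 1 / 2) (i : ℕ → Fin 2) : |coding m i - coding l i| ≤ 2 * |m - l| := by
  -- `2 * |m - l|` is the fixed point of `t ↦ t / 2 + |m - l|`; iterating from the trivial bound
  -- leaves an error `(1 / 2) ^ N`.
  have key : ∀ (N : ℕ) (i : ℕ → Fin 2),
      |coding m i - coding l i| ≤ 2 * |m - l| + (1 / 2) ^ N := by
    intro N
    induction N with
    | zero =>
      intro i
      have := coding_nonneg hl0 (by linarith) i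
      have := coding_nonneg hm0 (by linarith) i
      have := coding_le_one hl0 (by linarith) i
      have := coding_le_one hm0 (by linarith) i
      have := abs_nonneg (m - l)
      rw [abs_le]; constructor <;> norm_num <;> linarith
    | succ N ih =>
      intro i
      have e : coding m i - coding l i =
          m * (coding m (fun n => i (n + 1)) - coding l (fun n => i (n + 1))) +
            (m - l) * (coding l (fun n => i (n + 1)) - (i 0 : ℕ)) := by
        rw [coding_eq hl0 (by linarith) i, coding_eq hm0 (by linarith) i]
        unfold ifsMap
        ring
      have hd : |coding l (fun n => i (n + 1)) - ((i 0 : ℕ) : ℝ)| ≤ 1 := by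
        have := coding_nonneg hl0 (by linarith) (fun n => i (n + 1))
        have := coding_le_one hl0 (by linarith) (fun n => i (n + 1))
        have := digit_le_one (i 0)
        have : (0 : ℝ) ≤ ((i 0 : ℕ) : ℝ) := by positivity
        rw [abs_le]; constructor <;> linarith
      have h1 : m * |coding m (fun n => i (n + 1)) - coding l (fun n => i (n + 1))| ≤
          1 / 2 * (2 * |m - l| + (1 / 2) ^ N) :=
        mul_le_mul hm1 (ih _) (abs_nonneg _) (by norm_num)
      have h2 := mul_le_mul_of_nonneg_left hd (abs_nonneg (m - l))
      rw [e]
      refine (abs_add_le _ _).trans ?_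
      rw [abs_mul, abs_mul, abs_of_pos hm0, pow_succ]
      linarith
  have hlim : Tendsto (fun N : ℕ => 2 * |m - l| + (1 / 2 : ℝ) ^ N) atTop
      (𝓝 (2 * |m - l| + 0)) :=
    tendsto_const_nhds.add (tendsto_pow_atTop_nhds_zero_of_lt_one (by norm_num) (by norm_num))
  simpa using ge_of_tendsto' hlim fun N => key N i

theorem continuousOn_coding_left (i : ℕ → Fin 2) :
    ContinuousOn (fun l => coding l i) (Ioc 0 (1 / 2)) := by
  have : LipschitzOnWith 2 (fun l => coding l i) (Ioc 0 (1 / 2)) :=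
    LipschitzOnWith.of_dist_le_mul fun m hm l hl =>
      abs_coding_sub_le_two_mul hl.1 hl.2 hm.1 hm.2 i
  exact this.continuousOn

/-- Quantitative monotonicity of the coding in the ratio, for sequences starting with `0`. -/
theorem mul_coding_le_mul_coding {l m : ℝ} (h0 : 0 < l) (hlm : l ≤ m) (h1 : m < 1)
    {i : ℕ → Fin 2} (hi : i 0 = 0) :
    (1 - m) * m * coding l i ≤ (1 - l) * l * coding m i := by
  have hm0 : 0 < m := h0.trans_le hlm
  have hl1 : l < 1 := hlm.trans_lt h1
  have hsum : m * ∑' n : ℕ, ((i n : ℕ) : ℝ) * l ^ n ≤ l * ∑' n : ℕ, ((i n : ℕ) : ℝ) * m ^ n := by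
    rw [← tsum_mul_left, ← tsum_mul_left]
    refine Summable.tsum_le_tsum (fun n => ?_) ((summable_digits h0 hl1 i).mul_left m)
      ((summable_digits hm0 h1 i).mul_left l)
    cases n with
    -- The only term that needs first digit `0`: a digit `1` would require `m ≤ l`.
    | zero => simp [hi]
    | succ n =>
      have : ((i (n + 1) : ℕ) : ℝ) * l ^ n ≤ ((i (n + 1) : ℕ) : ℝ) * m ^ n :=
        mul_le_mul_of_nonneg_left (pow_le_pow_left₀ h0.le hlm n) (by positivity)
      calc m * (((i (n + 1) : ℕ) : ℝ) * l ^ (n + 1))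
          = m * l * (((i (n + 1) : ℕ) : ℝ) * l ^ n) := by ring
        _ ≤ m * l * (((i (n + 1) : ℕ) : ℝ) * m ^ n) :=
            mul_le_mul_of_nonneg_left this (by positivity)
        _ = l * (((i (n + 1) : ℕ) : ℝ) * m ^ (n + 1)) := by ring
  have hp : 0 ≤ (1 - m) * (1 - l) := mul_nonneg (by linarith) (by linarith)
  have := mul_le_mul_of_nonneg_left hsum hp
  unfold coding
  linarith

/-- The previous inequality compares with `t * (1 - t)`, whose increment factors as `(m - l) * (1 -
l - m)`, and `1 - l - m ≥ 1 - 2 * b`. -/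
theorem mul_sub_le_coding_sub {l m b : ℝ} (h0 : 0 < l) (hlm : l ≤ m) (hmb : m ≤ b)
    (hb : b < 1 / 2) {i : ℕ → Fin 2} (hi : i 0 = 0) :
    coding l i * (1 - 2 * b) * (m - l) ≤ coding m i - coding l i := by
  have h := mul_coding_le_mul_coding h0 hlm (by linarith) hi
  have hc := coding_nonneg h0 (by linarith) i
  have hl : 0 < (1 - l) * l := mul_pos (by linarith) h0
  have hl' : (1 - l) * l ≤ 1 := by nlinarith
  have h1 : coding l i * ((m - l) * (1 - l - m)) ≤ (1 - l) * l * (coding m i - coding l i) := by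
    linarith
  have h2 : coding l i * (1 - 2 * b) * (m - l) ≤ coding l i * ((m - l) * (1 - l - m)) := by
    rw [mul_assoc, mul_comm (1 - 2 * b)]
    exact mul_le_mul_of_nonneg_left
      (mul_le_mul_of_nonneg_left (by linarith) (by linarith)) hc
  have h3 : 0 ≤ coding l i * (1 - 2 * b) * (m - l) :=
    mul_nonneg (mul_nonneg hc (by linarith)) (by linarith)
  have h4 : 0 ≤ coding m i - coding l i :=
    nonneg_of_mul_nonneg_right ((h3.trans h2).trans h1) hl
  calc _ ≤ (1 - l) * l * (coding m i - coding l i) := h2.trans h1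
    _ ≤ _ := mul_le_of_le_one_left h4 hl'

theorem coding_lt_coding {l m : ℝ} (h0 : 0 < l) (hlm : l < m) (hm : m ≤ 1 / 2)
    {i : ℕ → Fin 2} (hi : i 0 = 0) (hpos : 0 < coding m i) : coding l i < coding m i := by
  have h := mul_coding_le_mul_coding h0 hlm.le (by linarith) hi
  have hlt : (1 - l) * l < (1 - m) * m := by nlinarith
  have hpm : 0 < (1 - m) * m := mul_pos (by linarith) (by linarith)
  have h2 : (1 - l) * l * coding m i < (1 - m) * m * coding m i :=
    mul_lt_mul_of_pos_right hlt hpos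
  exact lt_of_mul_lt_mul_left (h.trans_lt h2) hpm.le

/-- A first digit `1` already contributes `1 - l ≥ 1 / 2`. -/
theorem head_eq_zero {l : ℝ} (h0 : 0 < l) (hl : l ≤ 1 / 2) {i : ℕ → Fin 2}
    (h : coding l i < 1 / 2) : i 0 = 0 := by
  by_contra hne
  have hi : i 0 = 1 := by omega
  have := mul_nonneg h0.le (coding_nonneg h0 (by linarith) fun n => i (n + 1))
  rw [coding_eq h0 (by linarith) i, hi] at h
  unfold ifsMap at h
  norm_num at h
  linarith

/-! ### Binary expansions -/

/-- The self-similar set of ratio `1 / 2` is the unit interval. -/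
theorem selfSimilarSet_half : selfSimilarSet (1 / 2) = Icc 0 1 := by
  symm
  rw [← isAttractor_iff (by norm_num) (by norm_num)]
  refine ⟨⟨0, by simp⟩, isCompact_Icc, ?_⟩
  ext y
  rw [mem_ifs_iff, Fin.exists_fin_two]
  unfold ifsMap
  simp only [mem_Icc]
  constructor
  · rintro ⟨h0, h1⟩
    rcases le_total y (1 / 2) with h | h
    · exact Or.inl ⟨2 * y, ⟨by linarith, by linarith⟩, by norm_num; ring⟩
    · exact Or.inr ⟨2 * y - 1, ⟨by linarith, by linarith⟩, by norm_num; ring⟩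
  · rintro (⟨z, ⟨h0, h1⟩, rfl⟩ | ⟨z, ⟨h0, h1⟩, rfl⟩) <;> norm_num <;> constructor <;> linarith

/-- The sequence with the first `N` digits of `i`, followed by `j`. -/
def splice (N : ℕ) (i j : ℕ → Fin 2) (n : ℕ) : Fin 2 := if n < N then i n else j (n - N)

theorem splice_of_lt {N n : ℕ} (h : n < N) (i j : ℕ → Fin 2) : splice N i j n = i n := if_pos h

theorem coding_splice_sub {l : ℝ} (h0 : 0 < l) (h1 : l < 1) (N : ℕ) (i j k : ℕ → Fin 2) :
    coding l (splice N i j) - coding l (splice N i k) = l ^ N * (coding l j - coding l k) := by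
  induction N generalizing i with
  | zero =>
    have : ∀ j, splice 0 i j = j := fun j => by funext n; simp [splice]
    simp [this]
  | succ N ih =>
    have : ∀ j, (fun n => splice (N + 1) i j (n + 1)) = splice N (fun n => i (n + 1)) j :=
      fun j => by funext n; simp [splice]
    rw [coding_sub_of_head_eq h0 h1 (by simp [splice]), this, this, ih]
    ring

/-- The binary numbers with a given initial segment of digits fill an interval. -/
theorem exists_Icc_subset_coding_half_image (N : ℕ) (i : ℕ → Fin 2) :
    ∃ u v : ℝ, u < v ∧ Icc u v ⊆ coding (1 / 2) '' {j | ∀ k < N, j k = i k} := by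
  set u := coding (1 / 2) (splice N i 0) with hu
  have hp : (0 : ℝ) < (1 / 2) ^ N := by positivity
  refine ⟨u, u + (1 / 2) ^ N, by linarith, fun y hy => ?_⟩
  have hz : (y - u) / (1 / 2) ^ N ∈ selfSimilarSet (1 / 2) := by
    rw [selfSimilarSet_half]
    exact ⟨div_nonneg (by linarith [hy.1]) hp.le, (div_le_one hp).2 (by linarith [hy.2])⟩
  obtain ⟨j, hj⟩ := hz
  refine ⟨splice N i j, fun k hk => splice_of_lt hk _ _, ?_⟩
  have h := coding_splice_sub (l := 1 / 2) (by norm_num) (by norm_num) N i j 0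
  have h0 : coding (1 / 2) (0 : ℕ → Fin 2) = 0 := by simp [coding]
  rw [h0, hj, sub_zero, mul_div_cancel₀ _ hp.ne', ← hu] at h
  linarith

/-! ### Dimension bounds from cylinder estimates -/

theorem log_two_div_neg_log_pos {l : ℝ} (h0 : 0 < l) (h1 : l < 1) :
    0 < Real.log 2 / (-Real.log l) :=
  div_pos (Real.log_pos (by norm_num)) (neg_pos.2 (Real.log_neg h0 h1))

theorem rpow_log_two_div_neg_log {l : ℝ} (h0 : 0 < l) (h1 : l < 1) :
    l ^ (Real.log 2 / (-Real.log l)) = 1 / 2 := by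
  have h : Real.log l ≠ 0 := (Real.log_neg h0 h1).ne
  rw [Real.rpow_def_of_pos h0, show Real.log l * (Real.log 2 / -Real.log l) = -Real.log 2 by
    field_simp, Real.exp_neg, Real.exp_log (by norm_num), one_div]

theorem pow_rpow_log_two_div_neg_log {l : ℝ} (h0 : 0 < l) (h1 : l < 1) (n : ℕ) :
    (l ^ n) ^ (Real.log 2 / (-Real.log l)) = (1 / 2) ^ n := by
  rw [← Real.rpow_natCast, ← Real.rpow_mul h0.le, mul_comm, Real.rpow_mul h0.le,
    rpow_log_two_div_neg_log h0 h1, Real.rpow_natCast]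

/-- If cylinders of length `n` have images of diameter at most `C * b ^ n`, then the image has
dimension at most `log 2 / (-log b)`. -/
theorem dimH_image_le_of_prefix {S : Set (ℕ → Fin 2)} {f : (ℕ → Fin 2) → ℝ} {b C : ℝ}
    (hb0 : 0 < b) (hb1 : b < 1) (hC : 0 ≤ C)
    (h : ∀ n, ∀ i ∈ S, ∀ j ∈ S, (∀ k < n, i k = j k) → |f i - f j| ≤ C * b ^ n) :
    dimH (f '' S) ≤ ENNReal.ofReal (Real.log 2 / (-Real.log b)) := by
  set s := Real.log 2 / (-Real.log b) with hs
  have hs0 : 0 < s := log_two_div_neg_log_pos hb0 hb1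
  refine dimH_le_of_hausdorffMeasure_ne_top (d := s.toNNReal) ?_
  rw [Real.coe_toNNReal _ hs0.le]
  let t : ∀ n : ℕ, (Fin n → Fin 2) → Set ℝ := fun n w => f '' {i ∈ S | ∀ k : Fin n, i k = w k}
  have ht : ∀ n w, Metric.ediam (t n w) ≤ ENNReal.ofReal (C * b ^ n) := by
    intro n w
    refine Metric.ediam_le ?_
    rintro _ ⟨i, ⟨hi, hiw⟩, rfl⟩ _ ⟨j, ⟨hj, hjw⟩, rfl⟩
    rw [edist_dist, Real.dist_eq]
    exact ENNReal.ofReal_le_ofReal (h n i hi j hj fun k hk =>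
      (hiw ⟨k, hk⟩).trans (hjw ⟨k, hk⟩).symm)
  have hr : Tendsto (fun n : ℕ => ENNReal.ofReal (C * b ^ n)) atTop (𝓝 0) := by
    rw [← ENNReal.ofReal_zero, ← mul_zero C]
    exact ENNReal.tendsto_ofReal
      ((tendsto_pow_atTop_nhds_zero_of_lt_one hb0.le hb1).const_mul C)
  have hsum : ∀ n, ∑ w, Metric.ediam (t n w) ^ s ≤ ENNReal.ofReal (C ^ s) := by
    intro n
    calc ∑ w, Metric.ediam (t n w) ^ s ≤ ∑ _w : Fin n → Fin 2, ENNReal.ofReal ((C * b ^ n) ^ s) := by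
          refine Finset.sum_le_sum fun w _ => ?_
          rw [← ENNReal.ofReal_rpow_of_nonneg (by positivity) hs0.le]
          exact ENNReal.rpow_le_rpow (ht n w) hs0.le
      _ = ENNReal.ofReal (C ^ s) := by
          rw [Finset.sum_const, Finset.card_univ, Fintype.card_fun, Fintype.card_fin,
            Fintype.card_fin, ← ENNReal.ofReal_nsmul, Real.mul_rpow hC (by positivity),
            pow_rpow_log_two_div_neg_log hb0 hb1, nsmul_eq_mul]
          push_cast
          rw [mul_left_comm, ← mul_pow]
          norm_num
  have hle := Measure.hausdorffMeasure_le_liminf_sum s (f '' S) _ hr t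
    (Eventually.of_forall ht) (Eventually.of_forall fun n => by
      rintro _ ⟨i, hi, rfl⟩
      exact mem_iUnion.2 ⟨fun k => i k, i, ⟨hi, fun _ => rfl⟩, rfl⟩)
  refine (hle.trans_lt ((liminf_le_liminf (Eventually.of_forall hsum)).trans_lt ?_)).ne
  simp

/-- If sequences of `S` that first differ at index `n` have images at distance at least `c * a ^ n`
and `S` codes an interval of binary numbers, then the image of `S` has dimension at least
`log 2 / (-log a)`. -/
theorem le_dimH_image_of_prefix {S : Set (ℕ → Fin 2)} {f : (ℕ → Fin 2) → ℝ} {a c u v : ℝ}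
    (ha0 : 0 < a) (ha1 : a < 1) (hc : 0 < c) (huv : u < v) (hS : Icc u v ⊆ coding (1 / 2) '' S)
    (h : ∀ n, ∀ i ∈ S, ∀ j ∈ S, (∀ k < n, i k = j k) → i n ≠ j n → c * a ^ n ≤ |f i - f j|) :
    ENNReal.ofReal (Real.log 2 / (-Real.log a)) ≤ dimH (f '' S) := by
  set s := Real.log 2 / (-Real.log a) with hs
  have hs0 : 0 < s := log_two_div_neg_log_pos ha0 ha1
  -- Binary values differ by at most `(1 / 2) ^ n = (a ^ n) ^ s`, which turns the separation
  -- hypothesis into a Hölder bound of exponent `s`.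
  have key : ∀ i ∈ S, ∀ j ∈ S,
      |coding (1 / 2) i - coding (1 / 2) j| ≤ (c⁻¹) ^ s * |f i - f j| ^ s := by
    intro i hi j hj
    by_cases hij : i = j
    · subst hij
      rw [sub_self, abs_zero]
      positivity
    · have hex : ∃ n, i n ≠ j n := Function.ne_iff.1 hij
      classical
      have hmin : ∀ k < Nat.find hex, i k = j k := fun k hk => not_not.1 (Nat.find_min hex hk)
      refine (abs_coding_sub_le (by norm_num) (by norm_num) _ i j hmin).trans ?_
      rw [← pow_rpow_log_two_div_neg_log ha0 ha1, ← Real.mul_rpow (by positivity) (abs_nonneg _)]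
      refine Real.rpow_le_rpow (by positivity) ?_ hs0.le
      rw [inv_mul_eq_div, le_div_iff₀' hc]
      exact h _ i hi j hj hmin (Nat.find_spec hex)
  have hex : ∀ y ∈ f '' S, ∃ i, i ∈ S ∧ f i = y := fun y hy => hy
  choose! g hgS hg using hex
  have hhol : HolderOnWith ((c⁻¹) ^ s).toNNReal s.toNNReal (fun y => coding (1 / 2) (g y))
      (f '' S) := by
    intro y hy z hz
    have hk := key _ (hgS y hy) _ (hgS z hz)
    rw [hg y hy, hg z hz] at hk
    rw [edist_dist, edist_dist, Real.dist_eq, Real.dist_eq, Real.coe_toNNReal _ hs0.le,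
      ENNReal.ofReal_rpow_of_nonneg (abs_nonneg _) hs0.le]
    change _ ≤ ENNReal.ofReal _ * _
    rw [← ENNReal.ofReal_mul (by positivity)]
    exact ENNReal.ofReal_le_ofReal hk
  -- `key` shows that the binary value does not depend on which preimage `g` selects.
  have hsub : Icc u v ⊆ (fun y => coding (1 / 2) (g y)) '' (f '' S) := by
    intro y hy
    obtain ⟨i, hi, rfl⟩ := hS hy
    have hfi : f i ∈ f '' S := ⟨i, hi, rfl⟩
    refine ⟨f i, hfi, ?_⟩
    have hk := key _ (hgS _ hfi) _ hi
    rw [hg _ hfi, sub_self, abs_zero, Real.zero_rpow hs0.ne', mul_zero] at hk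
    exact sub_eq_zero.1 (abs_nonpos_iff.1 hk)
  have h1 : (1 : ENNReal) ≤ dimH (f '' S) / s.toNNReal := by
    have hI : dimH (Icc u v) = 1 := by
      rw [Real.dimH_of_nonempty_interior (by rw [interior_Icc]; exact nonempty_Ioo.2 huv)]
      simp
    rw [← hI]
    exact (dimH_mono hsub).trans (hhol.dimH_image_le (Real.toNNReal_pos.2 hs0))
  have hne : (s.toNNReal : ENNReal) ≠ 0 := by simpa using hs0
  rw [ENNReal.le_div_iff_mul_le (Or.inl hne) (Or.inl ENNReal.coe_ne_top), one_mul] at h1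
  exact h1

/-- The separation constant `1 - 2 * l` vanishes at `l = 1 / 2`, where the set is an interval
instead. -/
theorem dimH_selfSimilarSet {l : ℝ} (h0 : 0 < l) (hl : l ≤ 1 / 2) :
    dimH (selfSimilarSet l) = ENNReal.ofReal (Real.log 2 / (-Real.log l)) := by
  rcases hl.eq_or_lt with rfl | hlt
  · have h2 : Real.log 2 ≠ 0 := (Real.log_pos (by norm_num)).ne'
    rw [selfSimilarSet_half, Real.dimH_of_nonempty_interior (by rw [interior_Icc]; simp)]
    simp [h2]
  · rw [selfSimilarSet, ← image_univ]
    refine le_antisymm (dimH_image_le_of_prefix (C := 1) h0 (by linarith) zero_le_one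
      fun n i _ j _ h => ?_) (le_dimH_image_of_prefix (c := 1 - 2 * l) h0 (by linarith)
        (by linarith) zero_lt_one ?_ fun n i _ j _ h hn => ?_)
    · rw [one_mul]; exact abs_coding_sub_le h0 (by linarith) n i j h
    · rw [image_univ, ← selfSimilarSet, selfSimilarSet_half]
    · exact le_abs_coding_sub h0 (by linarith) n i j h hn

/-! ### Upper bound for the parameter set -/

theorem eq_of_coding_eq {x l m : ℝ} (hx : x ∈ Ioo (0 : ℝ) (1 / 2)) (hl : l ∈ Ioc (0 : ℝ) (1 / 2))
    (hm : m ∈ Ioc (0 : ℝ) (1 / 2)) {i : ℕ → Fin 2} (hil : coding l i = x) (him : coding m i = x) :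
    l = m := by
  have hi : i 0 = 0 := head_eq_zero hl.1 hl.2 (hil ▸ hx.2)
  rcases lt_trichotomy l m with h | h | h
  · have := coding_lt_coding hl.1 h hm.2 hi (him ▸ hx.1)
    linarith
  · exact h
  · have := coding_lt_coding hm.1 h hl.2 hi (hil ▸ hx.1)
    linarith

/-- Compare both codes at the larger ratio `m`: there `i` has risen above `x` in proportion to `m -
l`, while `j` has value `x` and shares `n` digits with `i`. -/
theorem mul_abs_sub_le_pow {x l m b : ℝ} (hx : x ∈ Ioo (0 : ℝ) (1 / 2)) (hb : b < 1 / 2)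
    (hl : l ∈ Ioc 0 b) (hm : m ∈ Ioc 0 b) {i j : ℕ → Fin 2} (hi : coding l i = x)
    (hj : coding m j = x) (n : ℕ) (h : ∀ k < n, i k = j k) :
    x * (1 - 2 * b) * |l - m| ≤ b ^ n := by
  wlog hlm : l ≤ m generalizing l m i j
  · rw [abs_sub_comm]
    exact this hm hl hj hi (fun k hk => (h k hk).symm) (le_of_not_ge hlm)
  have hi0 : i 0 = 0 := head_eq_zero hl.1 (hl.2.trans hb.le) (hi ▸ hx.2)
  have h1 := mul_sub_le_coding_sub hl.1 hlm hm.2 hb hi0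
  have h2 := (abs_le.1 (abs_coding_sub_le hm.1 (hm.2.trans_lt (by linarith)) n i j h)).2
  have h3 := pow_le_pow_left₀ hm.1.le hm.2 n
  rw [abs_sub_comm, abs_of_nonneg (sub_nonneg.2 hlm)]
  rw [hi] at h1
  linarith

theorem dimH_paramSet_inter_le {x b : ℝ} (hx : x ∈ Ioo (0 : ℝ) (1 / 2)) (hb0 : 0 < b)
    (hb : b < 1 / 2) :
    dimH (paramSet x ∩ Iic b) ≤ ENNReal.ofReal (Real.log 2 / (-Real.log b)) := by
  have hex : ∀ i ∈ {i | ∃ l ∈ Ioc 0 b, coding l i = x}, ∃ l, l ∈ Ioc 0 b ∧ coding l i = x :=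
    fun i hi => hi
  choose! f hf hfx using hex
  have hp : 0 < x * (1 - 2 * b) := mul_pos hx.1 (by linarith)
  refine (dimH_mono ?_).trans (dimH_image_le_of_prefix
    (S := {i | ∃ l ∈ Ioc 0 b, coding l i = x}) (f := f) (C := (x * (1 - 2 * b))⁻¹) hb0
    (by linarith) (by positivity) fun n i hi j hj h => ?_)
  · rintro l ⟨⟨hl, i, hi⟩, hlb⟩
    have hiS : i ∈ {i | ∃ l ∈ Ioc 0 b, coding l i = x} := ⟨l, ⟨hl.1, hlb⟩, hi⟩
    exact ⟨i, hiS, eq_of_coding_eq hx ⟨(hf i hiS).1, (hf i hiS).2.trans hb.le⟩ hl (hfx i hiS) hi⟩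
  · rw [inv_mul_eq_div, le_div_iff₀' hp]
    exact mul_abs_sub_le_pow hx hb (hf i hi) (hf j hj) (hfx i hi) (hfx j hj) n h

/-! ### Lower bound near a parameter -/

/-- A sequence whose coding passes strictly through `x` as the ratio runs over `[a, b]` gives many
parameters in `[a, b]`. -/
theorem le_dimH_paramSet_inter {x a b : ℝ} (ha : 0 < a) (hab : a ≤ b)
    (hb : b < 1 / 2) {i : ℕ → Fin 2} (hia : coding a i < x) (hib : x < coding b i) :
    ENNReal.ofReal (Real.log 2 / (-Real.log a)) ≤ dimH (paramSet x ∩ Icc a b) := by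
  have hb0 : 0 < b := ha.trans_le hab
  -- Strict crossing is stable under changing late digits, so a whole cylinder of codes crosses `x`.
  obtain ⟨N, hN⟩ : ∃ N, ∀ j : ℕ → Fin 2, (∀ k < N, j k = i k) →
      coding a j < x ∧ x < coding b j := by
    obtain ⟨N, hN⟩ := exists_pow_lt_of_lt_one
      (lt_min (sub_pos.2 hia) (sub_pos.2 hib)) (by linarith : b < 1)
    refine ⟨N, fun j hj => ?_⟩
    have h1 := (abs_le.1 (abs_coding_sub_le ha (by linarith) N j i hj)).2
    have h2 := (abs_le.1 (abs_coding_sub_le hb0 (by linarith) N j i hj)).1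
    have h3 := pow_le_pow_left₀ ha.le hab N
    have h4 := hN.trans_le (min_le_left _ _)
    have h5 := hN.trans_le (min_le_right _ _)
    constructor <;> linarith
  have hex : ∀ j ∈ {j | ∀ k < N, j k = i k}, ∃ l, l ∈ Icc a b ∧ coding l j = x := by
    intro j hj
    have hcont : ContinuousOn (fun l => coding l j) (Icc a b) :=
      (continuousOn_coding_left j).mono fun l hl => ⟨ha.trans_le hl.1, hl.2.trans hb.le⟩
    exact intermediate_value_Icc hab hcont ⟨(hN j hj).1.le, (hN j hj).2.le⟩
  choose! f hf hfx using hex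
  obtain ⟨u, v, huv, hsub⟩ := exists_Icc_subset_coding_half_image N i
  refine (le_dimH_image_of_prefix (f := f) (c := (1 - 2 * b) / 2) ha (by linarith) (by linarith)
    huv hsub fun n j hj k hk h hn => ?_).trans (dimH_mono ?_)
  · have hfj0 : 0 < f j := ha.trans_le (hf j hj).1
    have hfk0 : 0 < f k := ha.trans_le (hf k hk).1
    have hfjb := (hf j hj).2
    have hfkb := (hf k hk).2
    -- At ratio `f j` the code `j` has value `x`, which is also the value of `k` at ratio `f k`; so
    -- separation at one ratio is paid for by moving the ratio. The Lipschitz constant gives the `2`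
    -- in `c`.
    have h1 := le_abs_coding_sub hfj0 (by linarith) n j k h hn
    have h2 := abs_coding_sub_le_two_mul hfj0 (by linarith) hfk0 (by linarith) k
    rw [hfx j hj] at h1
    rw [hfx k hk, abs_sub_comm (f k)] at h2
    have h3 : (1 - 2 * b) * a ^ n ≤ (1 - 2 * f j) * f j ^ n :=
      mul_le_mul (by linarith) (pow_le_pow_left₀ ha.le (hf j hj).1 n) (by positivity)
        (by linarith)
    linarith
  · rintro _ ⟨j, hj, rfl⟩
    exact ⟨⟨⟨ha.trans_le (hf j hj).1, (hf j hj).2.trans hb.le⟩, j, hfx j hj⟩, hf j hj⟩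

/-- Every sequence coding `x` at ratio `l` can be perturbed so that its coding passes strictly
through `x` at a ratio close to `l` and smaller than `1 / 2`. -/
theorem exists_coding_lt_lt {x l a d : ℝ} (hx : x ∈ Ioo (0 : ℝ) (1 / 2)) (hl : l ∈ paramSet x)
    (ha : 0 < a) (hal : a < l) (hld : l < d) :
    ∃ b, a ≤ b ∧ b < d ∧ b < 1 / 2 ∧ ∃ i, coding a i < x ∧ x < coding b i := by
  obtain ⟨⟨hl0, hl2⟩, i, hi⟩ := hl
  rcases hl2.eq_or_lt with rfl | hlt
  -- The ratio cannot exceed `1 / 2`, so the code is changed instead: binary values of codes not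
  -- below `x` at ratio `a` form a closed set missing `x`, hence missing some `y` slightly above
  -- `x`.
  · have hFc : IsClosed (coding (1 / 2) '' {i | x ≤ coding a i}) :=
      (((isClosed_le continuous_const (continuous_coding ha (by linarith))).isCompact).image
        (continuous_coding (by norm_num) (by norm_num))).isClosed
    have hxF : x ∉ coding (1 / 2) '' {i | x ≤ coding a i} := by
      rintro ⟨j, hj, rfl⟩
      exact absurd hj (not_le.2 (coding_lt_coding ha hal le_rfl
        (head_eq_zero (by norm_num) le_rfl hx.2) hx.1))
    have hev : ∀ᶠ y in 𝓝[>] x, y ∉ coding (1 / 2) '' {i | x ≤ coding a i} ∧ y ∈ Ioo x (1 / 2) :=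
      inter_mem (nhdsWithin_le_nhds (hFc.isOpen_compl.mem_nhds hxF)) (Ioo_mem_nhdsGT hx.2)
    obtain ⟨y, hyF, hxy, hy⟩ := hev.exists
    obtain ⟨j, rfl⟩ : y ∈ selfSimilarSet (1 / 2) := by
      rw [selfSimilarSet_half]
      exact ⟨hx.1.le.trans hxy.le, by linarith⟩
    have hja : coding a j < x := not_le.1 fun h => hyF ⟨j, h, rfl⟩
    have hc : Tendsto (fun l => coding l j) (𝓝[<] (1 / 2)) (𝓝 (coding (1 / 2) j)) :=
      (continuousOn_coding_left j _ ⟨by norm_num, le_rfl⟩).mono_left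
        (nhdsWithin_le_of_mem (mem_of_superset (Ioo_mem_nhdsLT (by norm_num : (0 : ℝ) < 1 / 2))
          Ioo_subset_Ioc_self))
    obtain ⟨b, hxb, hb⟩ := ((hc.eventually_const_lt hxy).and (Ioo_mem_nhdsLT hal)).exists
    exact ⟨b, hb.1.le, hb.2.trans hld, hb.2, j, hja, hxb⟩
  · obtain ⟨b, hlb, hb⟩ := exists_between (lt_min hld hlt)
    have hi0 : i 0 = 0 := head_eq_zero hl0 hl2 (hi ▸ hx.2)
    have hb2 := hb.trans_le (min_le_right _ _)
    have hgt := mul_sub_le_coding_sub hl0 hlb.le le_rfl hb2 hi0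
    rw [hi] at hgt
    have hpos : 0 < x * (1 - 2 * b) * (b - l) :=
      mul_pos (mul_pos hx.1 (by linarith)) (by linarith)
    refine ⟨b, (hal.trans hlb).le, hb.trans_le (min_le_left _ _), hb2, i, ?_, by linarith⟩
    rw [← hi]
    exact coding_lt_coding ha hal hl2 hi0 (hi ▸ hx.1)

/-! ### Local dimension, full dimension and measure zero -/

theorem dimH_paramSet_le_one (x : ℝ) : dimH (paramSet x) ≤ 1 :=
  (dimH_mono (subset_univ _)).trans_eq Real.dimH_univ

theorem continuousAt_log_two_div {l : ℝ} (h0 : 0 < l) (h1 : l < 1) :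
    ContinuousAt (fun l => ENNReal.ofReal (Real.log 2 / (-Real.log l))) l :=
  ENNReal.continuous_ofReal.continuousAt.comp (continuousAt_const.div
    (Real.continuousAt_log h0.ne').neg (neg_ne_zero.2 (Real.log_neg h0 h1).ne))

theorem ofReal_log_two_div_half :
    ENNReal.ofReal (Real.log 2 / (-Real.log (1 / 2))) = 1 := by
  have h2 : Real.log 2 ≠ 0 := (Real.log_pos (by norm_num)).ne'
  simp [h2]

theorem tendsto_dimH_paramSet_inter {x l : ℝ} (hx : x ∈ Ioo (0 : ℝ) (1 / 2))
    (hl : l ∈ paramSet x) :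
    Tendsto (fun δ : ℝ => dimH (paramSet x ∩ Ioo (l - δ) (l + δ))) (𝓝[>] 0)
      (𝓝 (ENNReal.ofReal (Real.log 2 / (-Real.log l)))) := by
  have hl0 := hl.1.1
  have hl2 := hl.1.2
  have hcont := continuousAt_log_two_div hl0 (by linarith)
  have hlow : Tendsto (fun δ : ℝ => ENNReal.ofReal (Real.log 2 / (-Real.log (l - δ / 2))))
      (𝓝[>] 0) (𝓝 (ENNReal.ofReal (Real.log 2 / (-Real.log l)))) := by
    refine hcont.tendsto.comp (tendsto_nhdsWithin_of_tendsto_nhds ?_)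
    have h : Continuous fun δ : ℝ => l - δ / 2 := by fun_prop
    exact h.tendsto' 0 l (by simp)
  have hle : ∀ᶠ δ : ℝ in 𝓝[>] 0, ENNReal.ofReal (Real.log 2 / (-Real.log (l - δ / 2))) ≤
      dimH (paramSet x ∩ Ioo (l - δ) (l + δ)) := by
    filter_upwards [Ioo_mem_nhdsGT hl0] with δ hδ
    -- The choice `l - δ / 2` keeps `Icc a b` inside the open window and tends to `l`.
    obtain ⟨b, hab, hbd, hb2, i, hia, hib⟩ := exists_coding_lt_lt hx hl
      (a := l - δ / 2) (d := l + δ) (by linarith [hδ.1, hδ.2]) (by linarith [hδ.1])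
      (by linarith [hδ.1])
    refine (le_dimH_paramSet_inter (by linarith [hδ.1, hδ.2]) hab hb2 hia hib).trans
      (dimH_mono (inter_subset_inter_right _ fun y hy => ⟨?_, hy.2.trans_lt hbd⟩))
    linarith [hδ.1, hy.1]
  rcases hl2.eq_or_lt with rfl | hlt
  · refine tendsto_of_tendsto_of_tendsto_of_le_of_le' hlow tendsto_const_nhds hle ?_
    rw [ofReal_log_two_div_half]
    exact Eventually.of_forall fun δ =>
      (dimH_mono inter_subset_left).trans (dimH_paramSet_le_one x)
  · have hup : Tendsto (fun δ : ℝ => ENNReal.ofReal (Real.log 2 / (-Real.log (l + δ))))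
        (𝓝[>] 0) (𝓝 (ENNReal.ofReal (Real.log 2 / (-Real.log l)))) := by
      refine hcont.tendsto.comp (tendsto_nhdsWithin_of_tendsto_nhds ?_)
      have h : Continuous fun δ : ℝ => l + δ := by fun_prop
      exact h.tendsto' 0 l (by simp)
    refine tendsto_of_tendsto_of_tendsto_of_le_of_le' hlow hup hle ?_
    filter_upwards [Ioo_mem_nhdsGT (sub_pos.2 hlt)] with δ hδ
    refine (dimH_mono (inter_subset_inter_right _ fun y hy => hy.2.le)).trans
      (dimH_paramSet_inter_le hx (by linarith [hδ.1]) (by linarith [hδ.2]))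

theorem half_mem_paramSet {x : ℝ} (hx : x ∈ Ioo (0 : ℝ) (1 / 2)) : 1 / 2 ∈ paramSet x := by
  refine ⟨⟨by norm_num, le_rfl⟩, ?_⟩
  rw [selfSimilarSet_half]
  exact ⟨hx.1.le, by linarith [hx.2]⟩

theorem dimH_paramSet {x : ℝ} (hx : x ∈ Ioo (0 : ℝ) (1 / 2)) : dimH (paramSet x) = 1 := by
  refine le_antisymm (dimH_paramSet_le_one x) ?_
  rw [← ofReal_log_two_div_half]
  exact le_of_tendsto (tendsto_dimH_paramSet_inter hx (half_mem_paramSet hx))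
    (Eventually.of_forall fun δ => dimH_mono inter_subset_left)

/-- Below any `b < 1 / 2` the dimension is less than 1, so one-dimensional Hausdorff measure, which
is Lebesgue measure, vanishes; countably many such pieces miss only `1 / 2`. -/
theorem volume_paramSet {x : ℝ} (hx : x ∈ Ioo (0 : ℝ) (1 / 2)) : volume (paramSet x) = 0 := by
  have hb : ∀ b : ℝ, 0 < b → b < 1 / 2 → volume (paramSet x ∩ Iic b) = 0 := by
    intro b h0 h2
    have hlt : dimH (paramSet x ∩ Iic b) < (1 : NNReal) := by
      refine (dimH_paramSet_inter_le hx h0 h2).trans_lt ?_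
      rw [ENNReal.coe_one, ← ENNReal.ofReal_one, ENNReal.ofReal_lt_ofReal_iff one_pos,
        div_lt_one (neg_pos.2 (Real.log_neg h0 (by linarith))), lt_neg, ← Real.log_inv]
      exact Real.log_lt_log h0 (by linarith)
    have := hausdorffMeasure_of_dimH_lt hlt
    rwa [NNReal.coe_one, hausdorffMeasure_real] at this
  obtain ⟨u, -, hu, hlim⟩ := exists_seq_strictMono_tendsto' (by norm_num : (0 : ℝ) < 1 / 2)
  refine measure_mono_null (t := (⋃ n, paramSet x ∩ Iic (u n)) ∪ {1 / 2}) ?_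
    (measure_union_null (measure_iUnion_null fun n => hb _ (hu n).1 (hu n).2) (by simp))
  intro l hl
  rcases hl.1.2.eq_or_lt with h | h
  · exact Or.inr h
  · obtain ⟨n, hn⟩ := (hlim.eventually_const_lt h).exists
    exact Or.inl (mem_iUnion.2 ⟨n, hl, hn.le⟩)

end CantorParam

end

theorem theorem1p2 (x : ℝ) (hx : x ∈ Set.Ioo (0 : ℝ) (1 / 2)) :
    MeasureTheory.volume (CantorParam.paramSet x) = 0 ∧
    dimH (CantorParam.paramSet x) = 1 ∧
    ∀ l ∈ CantorParam.paramSet x,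
      Filter.Tendsto
        (fun δ : ℝ => dimH (CantorParam.paramSet x ∩ Set.Ioo (l - δ) (l + δ)))
        (nhdsWithin 0 (Set.Ioi 0))
        (nhds (ENNReal.ofReal (Real.log 2 / (-Real.log l)))) ∧
      dimH (CantorParam.selfSimilarSet l) = ENNReal.ofReal (Real.log 2 / (-Real.log l)) :=
  ⟨CantorParam.volume_paramSet hx, CantorParam.dimH_paramSet hx, fun _ hl =>
    ⟨CantorParam.tendsto_dimH_paramSet_inter hx hl,
      CantorParam.dimH_selfSimilarSet hl.1.1 hl.1.2⟩⟩
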